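/- **Setting.** Let $\vartheta_1$ be the unique solution of $\tan r=r$ in $(\pi,\tfrac32\pi)$. Put $$\psi(r)=\frac{1-r\cot r}{r^2}\quad (r\notin\pi\mathbb Z),\qquad \mathrm K_3(v)=2\psi(|v|)+\frac{\psi'(|v|)}{|v|}\,v_2^2\quad (v=(v_1,v_2)\in\mathbb R^2),$$ $$\Omega_{+,1}=\{v\in\mathbb R^2:\ v_1,v_2>0,\ |v|<\pi\},\qquad \Omega_{-,4}=\{v\in\mathbb R^2:\ v_2<0,\ \pi<v_1<|v|<\vartheta_1,\ \mathrm K_3(v)<0\},$$ $$\Lambda(v)=v_2\Big[\frac{\psi'(|v|)}{|v|}\,v_2\,v+2\psi(|v|)\,(0,1)\Big]\in\mathbb R^2 .$$ Let $\Upsilon(r)=\dfrac{r^2}{1-r\cot r}$ for $|r|<\vartheta_1$, with the removable singularities filled in ($\Upsilon(0)=3$, $\Upsilon(\pm\pi)=0$). For $X\in\mathbb R^2$ and $T\in\mathbb R^3$ let $$\mathbf D(X,T)^2=\sup_{\tau\in\mathbb R^3,\ |\tau|<\vartheta_1}\big(\Upsilon(|\tau|)\,|X|^2+4\,T\cdot\tau\big).$$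 For $r>0$ let $$\varphi_1(r)=\frac{r^2-\sin^2r}{r-\sin r\cos r},\qquad \varphi_2(r)=\frac{r\,(r^2-\sin^2r)}{r^2+r\sin r\cos r-2\sin^2r},\qquad \varphi_3=\sqrt{\varphi_1\varphi_2}.$$ **Theorem.** The supremum defining $\mathbf D(X,T)^2$ is finite for all $(X,T)\in\mathbb R^2\times\mathbb R^3$. Let $\theta=(\theta_1,\theta_2,0)$ with $(\theta_1,\theta_2)\in\Omega_{+,1}\cup\Omega_{-,4}$, let $u=(u_1,u_2,0)=(\Lambda(\theta_1,\theta_2),0)$ and $\bar w=\theta_2\,\psi(|\theta|)$, and set, with $e_2=(0,1,0)$ and $e_3=(0,0,1)$, $$\mathcal D(u;s)=\mathbf D\Big(\bar w\,s,\ \tfrac14\big(u+2\bar w\,s_1e_2+2\bar w\,s_2e_3\big)\Big)^2,\qquad s=(s_1,s_2)\in\mathbb R^2 .$$ Then $\bar s=(-1,0)$ is the unique (global) minimum point of $\mathcal D(u;\cdot)$ on $\mathbb R^2$. Moreover, $$\mathcal D(u;\bar s)=-\theta_2^2\,\psi(|\theta|)+u\cdot\theta=\frac{\theta_2^2}{|\theta|^2}\Big[\Big(\frac{|\theta|}{\sin|\theta|}\Big)^2-1\Big]=\frac{\varphi_1(|\theta|)}{|\theta|}\,u\cdot\theta$$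 $$=\varphi_2(|\theta|)\,u_1\,\frac{|\theta|}{\theta_1}=\varphi_3(|\theta|)\sqrt{u_1\Big(u_1+u_2\,\frac{\theta_2}{\theta_1}\Big)} .$$ -/

import Mathlib

/-- The plane and three-space with their Euclidean norms. Coordinates are numbered from `0`: the
coordinates `v₁, v₂` are `v 0, v 1`, and `τ₁, τ₂, τ₃` are `τ 0, τ 1, τ 2`. -/
abbrev Plane : Type := EuclideanSpace ℝ (Fin 2)

/-- Euclidean three-space. -/
abbrev Space : Type := EuclideanSpace ℝ (Fin 3)

/-- The equation `tan r = r` has exactly one solution in `(π, 3π/2)`. -/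
theorem existsUnique_tan_eq_self :
    ∃! r : ℝ, (Real.pi < r ∧ r < 3 / 2 * Real.pi) ∧ Real.tan r = r := by
  have hpi := Real.pi_pos
  have hcos : ∀ r : ℝ, Real.pi < r → r < 3 / 2 * Real.pi → Real.cos r < 0 := by
    intro r h1 h2
    have h := Real.cos_pos_of_mem_Ioo (x := r - Real.pi) ⟨by linarith, by linarith⟩
    rw [Real.cos_sub_pi] at h
    linarith
  have hanti : StrictAntiOn (fun r : ℝ => Real.sin r - r * Real.cos r)
      (Set.Icc Real.pi (3 / 2 * Real.pi)) := by
    apply strictAntiOn_of_deriv_neg (convex_Icc _ _)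
    · fun_prop
    · intro x hx
      rw [interior_Icc] at hx
      have hd : HasDerivAt (fun r : ℝ => Real.sin r - r * Real.cos r)
          (Real.cos x - (1 * Real.cos x + x * -Real.sin x)) x :=
        (Real.hasDerivAt_sin x).sub ((hasDerivAt_id x).mul (Real.hasDerivAt_cos x))
      rw [hd.deriv]
      have hs := Real.sin_pos_of_pos_of_lt_pi (x := x - Real.pi)
        (by linarith [hx.1]) (by linarith [hx.2])
      rw [Real.sin_sub_pi] at hs
      nlinarith [hx.1]
  have hiff : ∀ r : ℝ, Real.pi < r → r < 3 / 2 * Real.pi →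
      (Real.tan r = r ↔ Real.sin r - r * Real.cos r = 0) := by
    intro r h1 h2
    rw [Real.tan_eq_sin_div_cos, div_eq_iff (hcos r h1 h2).ne, sub_eq_zero]
  have hval : Real.cos (3 / 2 * Real.pi) = 0 ∧ Real.sin (3 / 2 * Real.pi) = -1 := by
    have h : 3 / 2 * Real.pi = Real.pi / 2 + Real.pi := by ring
    rw [h, Real.cos_add_pi, Real.sin_add_pi]
    simp
  obtain ⟨r, hr, hr0⟩ : (0 : ℝ) ∈ (fun r : ℝ => Real.sin r - r * Real.cos r) ''
      Set.Ioo Real.pi (3 / 2 * Real.pi) := by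
    apply intermediate_value_Ioo' (by linarith) (by fun_prop)
    constructor
    · simp [hval.1, hval.2]
    · simp [hpi]
  refine ⟨r, ⟨hr, (hiff r hr.1 hr.2).2 hr0⟩, ?_⟩
  rintro y ⟨⟨hy1, hy2⟩, hy⟩
  exact hanti.injOn ⟨hy1.le, hy2.le⟩ ⟨hr.1.le, hr.2.le⟩
    (((hiff y hy1 hy2).1 hy).trans hr0.symm)

/-- `ϑ₁`, the unique solution of `tan r = r` in `(π, 3π/2)`. -/
noncomputable def vartheta₁ : ℝ := Classical.choose existsUnique_tan_eq_self.exists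

theorem vartheta₁_spec :
    (Real.pi < vartheta₁ ∧ vartheta₁ < 3 / 2 * Real.pi) ∧ Real.tan vartheta₁ = vartheta₁ :=
  Classical.choose_spec existsUnique_tan_eq_self.exists

/-- `ψ(ρ) = (1 - ρ cot ρ) / ρ²`, used only at `0 < ρ < ϑ₁`, `ρ ≠ π`. -/
noncomputable def psi (ρ : ℝ) : ℝ := (1 - ρ * Real.cot ρ) / ρ ^ 2

/-- `K₃(v) = 2 ψ(r) + (ψ'(r) / r) v₂²` with `r = |v|`. -/
noncomputable def K₃ (v : Plane) : ℝ := 2 * psi ‖v‖ + deriv psi ‖v‖ / ‖v‖ * v 1 ^ 2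

/-- `Ω_{+,1}`, the open quarter disc of radius `π`. -/
def OmegaPlus : Set Plane := {v | 0 < v 0 ∧ 0 < v 1 ∧ v 0 ^ 2 + v 1 ^ 2 < Real.pi ^ 2}

/-- `Ω_{-,4}`. -/
def OmegaMinus : Set Plane :=
  {v | v 1 < 0 ∧ Real.pi < v 0 ∧ v 0 < ‖v‖ ∧ ‖v‖ < vartheta₁ ∧ K₃ v < 0}

/-- `Λ(v) = v₂ [ (ψ'(r) / r) v₂ v + 2 ψ(r) e₂ ]` with `r = |v|`. -/
noncomputable def Lam (v : Plane) : Plane :=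
  v 1 • ((deriv psi ‖v‖ / ‖v‖ * v 1) • v + (2 * psi ‖v‖) • !₂[0, 1])

/-- `Υ(r) = r² / (1 - r cot r)` on `(-ϑ₁, ϑ₁)`, with its removable singularities filled in. The
fraction has been expanded by `sin r`, which gives the value `0` at `r = ±π`; the value at `r = 0`
is the limit `3`. -/
noncomputable def Upsilon (r : ℝ) : ℝ :=
  if r = 0 then 3 else r ^ 2 * Real.sin r / (Real.sin r - r * Real.cos r)

theorem Upsilon_eq {r : ℝ} (hr : Real.sin r ≠ 0) :
    Upsilon r = r ^ 2 / (1 - r * Real.cot r) := by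
  have h0 : r ≠ 0 := by
    rintro rfl
    simp at hr
  have h : 1 - r * Real.cot r = (Real.sin r - r * Real.cos r) / Real.sin r := by
    rw [Real.cot_eq_cos_div_sin]
    field_simp
  rw [Upsilon, if_neg h0, h, div_div_eq_mul_div]

/-- `Γ((X, T); τ) = Υ(|τ|) |X|² + 4 T · τ`, for `|τ| < ϑ₁`. -/
noncomputable def Gam (X : Plane) (T τ : Space) : ℝ :=
  Upsilon ‖τ‖ * ‖X‖ ^ 2 + 4 * inner ℝ T τ

/-- The squared intrinsic distance `𝐃(X, T)²`, the supremum of `Γ((X, T); ·)` over the open ball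
of radius `ϑ₁`. -/
noncomputable def intrinsicDistSq (X : Plane) (T : Space) : ℝ :=
  sSup (Gam X T '' Metric.ball 0 vartheta₁)

/-- `𝒟(u; s) = 𝐃(w s, ¼ (u + 2 w s₁ e₂ + 2 w s₂ e₃))²`. -/
noncomputable def calD (w : ℝ) (u : Space) (s : Plane) : ℝ :=
  intrinsicDistSq (w • s)
    ((1 / 4 : ℝ) • (u + (2 * w * s 0) • !₂[0, 1, 0] + (2 * w * s 1) • !₂[0, 0, 1]))

/-- `φ₁(r) = (r² - sin² r) / (r - sin r cos r)`. -/
noncomputable def phi₁ (r : ℝ) : ℝ :=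
  (r ^ 2 - Real.sin r ^ 2) / (r - Real.sin r * Real.cos r)

/-- `φ₂(r) = r (r² - sin² r) / h(r)`, where `h(r) = r² + r sin r cos r - 2 sin² r`. -/
noncomputable def phi₂ (r : ℝ) : ℝ :=
  r * (r ^ 2 - Real.sin r ^ 2) /
    (r ^ 2 + r * Real.sin r * Real.cos r - 2 * Real.sin r ^ 2)

/-- `φ₃ = √(φ₁ φ₂)`. -/
noncomputable def phi₃ (r : ℝ) : ℝ := √(phi₁ r * phi₂ r)

/-! `Υ` is strictly concave on `(0, ϑ₁)`: its second derivative has the sign of `-curvNum`. So a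
critical point of `Γ` is a maximum, by the tangent to `Υ` in the radius and Cauchy–Schwarz in the
direction (`intrinsicDistSq_eq_of_critical`). At `s = (-1, 0)` that point is `θ`, which gives the
value `m`.

For strict minimality it suffices to find, for every other `s`, one `τ` at which `Γ` exceeds `m`. If
`|θ| < π`, then `τ = θ` serves: since `Υ ψ = 1`, the excess is `θ₂² ψ ((s₁ + 1)² + s₂²)`. On
`Ω_{-,4}` this fails, as `ψ < 0`. There only `x = |X|²` and `q = 4|T|` matter, and the pairs with
supremum at most `m` are bounded by `m` times the curve dual to the graph of `Υ`. For radii in `[π,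
ϑ₁]` the square of its second coordinate is concave in the first (`dualB_sq_le_tangent`), so `q²`
above a tangent forces the supremum above `m` (`exists_lt_Upsilon_mul_add`). Here `q²` exceeds the
tangent at `|θ|` by two nonnegative terms that vanish together only at `(-1, 0)`; their sign comes
from `u₂ = θ₂ K₃ > 0`. -/

open Real Set Filter Topology

/-! ### Trigonometric functions and their signs on `(0, ϑ₁)` -/

/-- `sin r - r cos r`, the denominator of `Υ`. -/
noncomputable def sinSubMulCos (r : ℝ) : ℝ := sin r - r * cos r

/-- The denominator `h` of `φ₂`. -/
noncomputable def hFun (r : ℝ) : ℝ := r ^ 2 + r * sin r * cos r - 2 * sin r ^ 2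

/-- The numerator of the second derivative of `-Υ / 2`. -/
noncomputable def curvNum (r : ℝ) : ℝ :=
  3 * r ^ 2 * sin r - sin r ^ 3 - 2 * r ^ 3 * cos r - r ^ 4 * sin r

theorem pos_of_hasDerivAt_pos {f f' : ℝ → ℝ} {b : ℝ} (h0 : f 0 = 0)
    (hf : ∀ x, HasDerivAt f (f' x) x) (hpos : ∀ x, 0 < x → x < b → 0 < f' x)
    {x : ℝ} (hx0 : 0 < x) (hxb : x ≤ b) : 0 < f x := by
  have hmono : StrictMonoOn f (Icc 0 b) := by
    apply strictMonoOn_of_deriv_pos (convex_Icc _ _)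
    · exact fun y _ => (hf y).continuousAt.continuousWithinAt
    · intro y hy
      rw [interior_Icc] at hy
      rw [(hf y).deriv]
      exact hpos y hy.1 hy.2
  have := hmono ⟨le_rfl, hx0.le.trans hxb⟩ ⟨hx0.le, hxb⟩ hx0
  rwa [h0] at this

theorem hasDerivAt_sinSubMulCos (r : ℝ) : HasDerivAt sinSubMulCos (r * sin r) r := by
  have := (hasDerivAt_sin r).sub ((hasDerivAt_id r).mul (hasDerivAt_cos r))
  refine this.congr_deriv ?_
  simp

theorem hasDerivAt_hFun (r : ℝ) :
    HasDerivAt hFun (3 * r - 2 * r * sin r ^ 2 - 3 * sin r * cos r) r := by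
  have h1 := hasDerivAt_sin r
  have h2 := hasDerivAt_cos r
  have := (((hasDerivAt_id r).pow 2).add (((hasDerivAt_id r).mul h1).mul h2)).sub
    ((h1.pow 2).const_mul 2)
  refine this.congr_deriv ?_
  simp
  linear_combination (-r) * (sin_sq_add_cos_sq r) + 2 * r * (sin_sq_add_cos_sq r)

theorem hasDerivAt_curvNum (r : ℝ) :
    HasDerivAt curvNum (6 * r * sin r - 3 * r ^ 2 * cos r - 3 * sin r ^ 2 * cos r
      - 2 * r ^ 3 * sin r - r ^ 4 * cos r) r := by
  have h1 := hasDerivAt_sin r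
  have h2 := hasDerivAt_cos r
  have := ((((((hasDerivAt_id r).pow 2).const_mul 3).mul h1).sub (h1.pow 3)).sub
    ((((hasDerivAt_id r).pow 3).const_mul 2).mul h2)).sub (((hasDerivAt_id r).pow 4).mul h1)
  refine this.congr_deriv ?_
  simp
  ring

theorem pi_lt_vartheta₁ : π < vartheta₁ := vartheta₁_spec.1.1

theorem vartheta₁_pos : 0 < vartheta₁ := pi_pos.trans pi_lt_vartheta₁

theorem cos_neg_of_mem {r : ℝ} (h1 : π ≤ r) (h2 : r ≤ vartheta₁) : cos r < 0 := by
  have h := cos_pos_of_mem_Ioo (x := r - π)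
    ⟨by linarith [pi_pos], by linarith [vartheta₁_spec.1.2]⟩
  rw [cos_sub_pi] at h
  linarith

theorem sin_neg_of_mem {r : ℝ} (h1 : π < r) (h2 : r ≤ vartheta₁) : sin r < 0 := by
  have h := sin_pos_of_pos_of_lt_pi (x := r - π) (by linarith)
    (by linarith [vartheta₁_spec.1.2, pi_pos])
  rw [sin_sub_pi] at h
  linarith

theorem sinSubMulCos_vartheta₁ : sinSubMulCos vartheta₁ = 0 := by
  have h := vartheta₁_spec.2
  rw [tan_eq_sin_div_cos, div_eq_iff (cos_neg_of_mem pi_lt_vartheta₁.le le_rfl).ne] at h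
  rw [sinSubMulCos, sub_eq_zero, h]

theorem sinSubMulCos_pos {r : ℝ} (h0 : 0 < r) (h1 : r < vartheta₁) : 0 < sinSubMulCos r := by
  rcases le_or_gt r π with h | h
  · refine pos_of_hasDerivAt_pos (by simp [sinSubMulCos]) hasDerivAt_sinSubMulCos ?_ h0 h
    exact fun x hx0 hx => mul_pos hx0 (sin_pos_of_pos_of_lt_pi hx0 hx)
  · have hanti : StrictAntiOn sinSubMulCos (Icc π vartheta₁) := by
      apply strictAntiOn_of_deriv_neg (convex_Icc _ _)
      · exact fun y _ => (hasDerivAt_sinSubMulCos y).continuousAt.continuousWithinAt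
      · intro y hy
        rw [interior_Icc] at hy
        rw [(hasDerivAt_sinSubMulCos y).deriv]
        exact mul_neg_of_pos_of_neg (pi_pos.trans hy.1) (sin_neg_of_mem hy.1 hy.2.le)
    have := hanti ⟨h.le, h1.le⟩ ⟨pi_lt_vartheta₁.le, le_rfl⟩ h1
    rwa [sinSubMulCos_vartheta₁] at this

theorem sq_sub_sin_sq_pos {r : ℝ} (h0 : 0 < r) : 0 < r ^ 2 - sin r ^ 2 := by
  have := sin_sq_lt_sq h0.ne'
  linarith

theorem sub_sin_mul_cos_pos {r : ℝ} (h0 : 0 < r) : 0 < r - sin r * cos r := by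
  have := sin_lt (x := 2 * r) (by linarith)
  rw [sin_two_mul] at this
  linarith

theorem deriv_hFun_pos_of_pi_le {r : ℝ} (h : π ≤ r) :
    0 < 3 * r - 2 * r * sin r ^ 2 - 3 * sin r * cos r := by
  have h3 := pi_gt_three
  nlinarith [sin_sq_add_cos_sq r, sq_nonneg (sin r - cos r), sq_nonneg (cos r)]

/-- Up to `π`, both `h` and `h'` vanish at `0` and `h'' = 4 sin r (sin r - r cos r) > 0`. Beyond
`π`, the term `r²` dominates. -/
theorem hFun_pos {r : ℝ} (h0 : 0 < r) : 0 < hFun r := by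
  rcases le_or_gt r π with h | h
  · refine pos_of_hasDerivAt_pos (by simp [hFun]) hasDerivAt_hFun ?_ h0 h
    intro x hx0 hx
    have hd : ∀ r : ℝ, HasDerivAt (fun r => 3 * r - 2 * r * sin r ^ 2 - 3 * sin r * cos r)
        (4 * (sin r * sinSubMulCos r)) r := by
      intro r
      have h1 := hasDerivAt_sin r
      have h2 := hasDerivAt_cos r
      have := (((hasDerivAt_id r).const_mul 3).sub
        (((hasDerivAt_id r).const_mul 2).mul (h1.pow 2))).sub ((h1.const_mul 3).mul h2)
      refine this.congr_deriv ?_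
      simp [sinSubMulCos]
      linear_combination (-3) * (sin_sq_add_cos_sq r)
    refine pos_of_hasDerivAt_pos (b := π) (by simp) hd ?_ hx0 hx.le
    exact fun y hy0 hy => mul_pos (by norm_num) (mul_pos (sin_pos_of_pos_of_lt_pi hy0 hy)
      (sinSubMulCos_pos hy0 (hy.trans pi_lt_vartheta₁)))
  · have h3 := pi_gt_three
    unfold hFun
    nlinarith [sin_sq_add_cos_sq r, sq_nonneg (sin r + cos r), sq_nonneg (cos r)]

theorem tendsto_div_sin : Tendsto (fun r : ℝ => r / sin r) (𝓝[>] 0) (𝓝 1) := by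
  have h : Tendsto (fun r : ℝ => sin r / r) (𝓝[≠] 0) (𝓝 1) := by
    have := (hasDerivAt_iff_tendsto_slope.1 (hasDerivAt_sin 0))
    rw [cos_zero] at this
    refine this.congr fun r => ?_
    simp [slope_def_field]
  have h2 := (h.mono_left (nhdsWithin_mono 0 fun x (hx : 0 < x) => hx.ne')).inv₀ one_ne_zero
  rw [inv_one] at h2
  exact h2.congr fun r => inv_div _ _

/-- Below `π` the quotient by `sin³` increases from the limit `0`; above `π`, where `sin < 0`, the
function splits into positive terms. -/
theorem curvNum_pos {r : ℝ} (h0 : 0 < r) (h1 : r < vartheta₁) : 0 < curvNum r := by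
  rcases lt_trichotomy r π with h | h | h
  · have hd : ∀ x ∈ Ioo 0 π, HasDerivAt (fun x => curvNum x / sin x ^ 3)
        (2 * x * sinSubMulCos x * (3 * sinSubMulCos x - x ^ 2 * sin x) / sin x ^ 4) x := by
      intro x hx
      have hs := (sin_pos_of_pos_of_lt_pi hx.1 hx.2).ne'
      have := (hasDerivAt_curvNum x).div ((hasDerivAt_sin x).pow 3) (pow_ne_zero 3 hs)
      refine this.congr_deriv ?_
      simp only [curvNum, sinSubMulCos]
      simp only [Pi.pow_apply]
      rw [div_eq_div_iff (pow_ne_zero 2 (pow_ne_zero 3 hs)) (pow_ne_zero 4 hs)]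
      push_cast
      ring
    have hmono : StrictMonoOn (fun x => curvNum x / sin x ^ 3) (Ioo 0 π) := by
      apply strictMonoOn_of_deriv_pos (convex_Ioo _ _)
      · exact fun y hy => (hd y hy).continuousAt.continuousWithinAt
      · intro y hy
        rw [interior_Ioo] at hy
        rw [(hd y hy).deriv]
        have hs := sin_pos_of_pos_of_lt_pi hy.1 hy.2
        have hD := sinSubMulCos_pos hy.1 (hy.2.trans pi_lt_vartheta₁)
        have hU : 0 < 3 * sinSubMulCos y - y ^ 2 * sin y := by
          refine pos_of_hasDerivAt_pos (f := fun y => 3 * sinSubMulCos y - y ^ 2 * sin y)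
            (f' := fun y => y * sinSubMulCos y) (b := π) (by simp [sinSubMulCos]) ?_ ?_ hy.1 hy.2.le
          · intro x
            refine (((hasDerivAt_sinSubMulCos x).const_mul 3).sub
              (((hasDerivAt_id x).pow 2).mul (hasDerivAt_sin x))).congr_deriv ?_
            simp [sinSubMulCos]
            ring
          · exact fun x hx0 hx => mul_pos hx0 (sinSubMulCos_pos hx0 (hx.trans pi_lt_vartheta₁))
        have := hy.1
        positivity
    have hlim : Tendsto (fun x => curvNum x / sin x ^ 3) (𝓝[>] 0) (𝓝 0) := by
      have hid : Tendsto (fun x : ℝ => x) (𝓝[>] 0) (𝓝 0) := nhdsWithin_le_nhds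
      have hcos : Tendsto cos (𝓝[>] 0) (𝓝 1) := by
        have := (continuous_cos.tendsto 0).mono_left (nhdsWithin_le_nhds (s := Ioi 0))
        rwa [cos_zero] at this
      have ht := tendsto_div_sin
      have := ((((ht.pow 2).const_mul 3).sub_const 1).sub
        (((ht.pow 3).mul hcos).const_mul 2)).sub ((ht.pow 2).mul (hid.pow 2))
      have h00 : (3 * 1 ^ 2 - 1 - 2 * (1 ^ 3 * 1) - 1 ^ 2 * 0 ^ 2 : ℝ) = 0 := by norm_num
      rw [h00] at this
      refine this.congr' ?_
      filter_upwards [Ioo_mem_nhdsGT pi_pos] with x hx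
      have hs := (sin_pos_of_pos_of_lt_pi hx.1 hx.2).ne'
      simp only [curvNum]
      field_simp
    have hs := sin_pos_of_pos_of_lt_pi h0 h
    -- The limit at `0` gives only a weak inequality; the detour through `r / 2` makes it strict.
    have hhalf : 0 ≤ curvNum (r / 2) / sin (r / 2) ^ 3 := by
      refine le_of_tendsto hlim ?_
      filter_upwards [Ioo_mem_nhdsGT (half_pos h0)] with x hx
      exact (hmono ⟨hx.1, by linarith [hx.2]⟩ ⟨by linarith, by linarith⟩ hx.2).le
    have := hhalf.trans_lt (hmono (a := r / 2) (b := r) ⟨by linarith, by linarith⟩ ⟨h0, h⟩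
      (by linarith))
    exact (div_pos_iff_of_pos_right (by positivity)).1 this
  · subst h
    simp only [curvNum, sin_pi, cos_pi]
    have := pi_pos
    ring_nf
    positivity
  · have hd := sinSubMulCos_pos h0 h1
    have h2 := sq_sub_sin_sq_pos h0
    have h3 := sub_sin_mul_cos_pos h0
    have h4 := sin_neg_of_mem h h1.le
    have key : curvNum r = sinSubMulCos r * (r ^ 2 - sin r ^ 2)
        + r * sinSubMulCos r * (r - sin r * cos r) + r ^ 2 * (-sin r) * (r ^ 2 - sin r ^ 2) := by
      simp only [curvNum, sinSubMulCos]
      linear_combination (-(r ^ 2 * sin r)) * (sin_sq_add_cos_sq r)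
    rw [key]
    have h5 : 0 < -sin r := by linarith
    positivity

/-! ### Concavity of `Υ` -/

theorem Upsilon_of_ne {r : ℝ} (h : r ≠ 0) : Upsilon r = r ^ 2 * sin r / sinSubMulCos r := by
  rw [Upsilon, if_neg h, sinSubMulCos]

theorem Upsilon_pi : Upsilon π = 0 := by
  rw [Upsilon_of_ne pi_ne_zero]
  simp

theorem hasDerivAt_Upsilon {r : ℝ} (h0 : r ≠ 0) (hd : sinSubMulCos r ≠ 0) :
    HasDerivAt Upsilon (-(r * hFun r / sinSubMulCos r ^ 2)) r := by
  have h := (((hasDerivAt_id r).pow 2).mul (hasDerivAt_sin r)).div (hasDerivAt_sinSubMulCos r) hd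
  have h' : HasDerivAt (fun r => r ^ 2 * sin r / sinSubMulCos r)
      (-(r * hFun r / sinSubMulCos r ^ 2)) r := by
    refine h.congr_deriv ?_
    rw [neg_div', div_left_inj' (pow_ne_zero 2 hd)]
    simp [hFun, sinSubMulCos]
    linear_combination (-r ^ 3) * (sin_sq_add_cos_sq r)
  refine h'.congr_of_eventuallyEq ?_
  filter_upwards [isOpen_ne.mem_nhds h0] with x hx
  exact Upsilon_of_ne hx

theorem hasDerivAt_mul_hFun_div {r : ℝ} (hd : sinSubMulCos r ≠ 0) :
    HasDerivAt (fun r => r * hFun r / sinSubMulCos r ^ 2)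
      (2 * curvNum r / sinSubMulCos r ^ 3) r := by
  have h := ((hasDerivAt_id r).mul (hasDerivAt_hFun r)).div ((hasDerivAt_sinSubMulCos r).pow 2)
    (pow_ne_zero 2 hd)
  refine h.congr_deriv ?_
  simp only [Pi.pow_apply]
  rw [div_eq_div_iff (pow_ne_zero 2 (pow_ne_zero 2 hd)) (pow_ne_zero 3 hd)]
  have hkey : (hFun r + r * (3 * r - 2 * r * sin r ^ 2 - 3 * sin r * cos r)) * sinSubMulCos r
      - 2 * r ^ 2 * hFun r * sin r = 2 * curvNum r := by
    have hc : cos r ^ 2 = 1 - sin r ^ 2 := by linarith [sin_sq_add_cos_sq r]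
    simp only [hFun, sinSubMulCos, curvNum]
    ring_nf
    simp only [hc]
    ring
  rw [← hkey]
  simp
  ring

theorem strictAntiOn_neg_mul_hFun_div :
    StrictAntiOn (fun r => -(r * hFun r / sinSubMulCos r ^ 2)) (Ioo 0 vartheta₁) := by
  have hd : ∀ r ∈ Ioo 0 vartheta₁, HasDerivAt (fun r => -(r * hFun r / sinSubMulCos r ^ 2))
      (-(2 * curvNum r / sinSubMulCos r ^ 3)) r := fun r hr =>
    (hasDerivAt_mul_hFun_div (sinSubMulCos_pos hr.1 hr.2).ne').neg
  apply strictAntiOn_of_deriv_neg (convex_Ioo _ _)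
  · exact fun r hr => (hd r hr).continuousAt.continuousWithinAt
  · intro r hr
    rw [interior_Ioo] at hr
    rw [(hd r hr).deriv]
    have := sinSubMulCos_pos hr.1 hr.2
    have := curvNum_pos hr.1 hr.2
    rw [neg_lt_zero]
    positivity

theorem Upsilon_le_tangent_of_pos {r r₀ : ℝ} (hr : r ∈ Ioo 0 vartheta₁)
    (hr₀ : r₀ ∈ Ioo 0 vartheta₁) :
    Upsilon r ≤ Upsilon r₀ - r₀ * hFun r₀ / sinSubMulCos r₀ ^ 2 * (r - r₀) := by
  have hD : ∀ r ∈ Ioo 0 vartheta₁, HasDerivAt Upsilon (-(r * hFun r / sinSubMulCos r ^ 2)) r :=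
    fun r hr => hasDerivAt_Upsilon hr.1.ne' (sinSubMulCos_pos hr.1 hr.2).ne'
  have hconc : ConcaveOn ℝ (Ioo 0 vartheta₁) Upsilon := by
    apply AntitoneOn.concaveOn_of_deriv (convex_Ioo _ _)
    · exact fun r hr => (hD r hr).continuousAt.continuousWithinAt
    · rw [interior_Ioo]
      exact fun r hr => (hD r hr).differentiableAt.differentiableWithinAt
    · rw [interior_Ioo]
      refine strictAntiOn_neg_mul_hFun_div.antitoneOn.congr fun r hr => ?_
      exact (hD r hr).deriv.symm
  rcases lt_trichotomy r r₀ with h | h | h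
  · have := hconc.le_slope_of_hasDerivAt hr hr₀ h (hD r₀ hr₀)
    rw [slope_def_field, le_div_iff₀ (by linarith)] at this
    linarith
  · subst h; simp
  · have := hconc.slope_le_of_hasDerivAt hr₀ hr h (hD r₀ hr₀)
    rw [slope_def_field, div_le_iff₀ (by linarith)] at this
    linarith

/-- The graph of `Υ` lies below each of its tangents. -/
theorem Upsilon_le_tangent {r r₀ : ℝ} (h0 : 0 ≤ r) (h1 : r < vartheta₁)
    (hr₀ : r₀ ∈ Ioo 0 vartheta₁) :
    Upsilon r ≤ Upsilon r₀ - r₀ * hFun r₀ / sinSubMulCos r₀ ^ 2 * (r - r₀) := by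
  rcases h0.eq_or_lt with rfl | h0
  · rw [Upsilon, if_pos rfl]
    have hL : Tendsto (fun r => Upsilon r₀ - r₀ * hFun r₀ / sinSubMulCos r₀ ^ 2 * (r - r₀))
        (𝓝[>] 0) (𝓝 (Upsilon r₀ - r₀ * hFun r₀ / sinSubMulCos r₀ ^ 2 * (0 - r₀))) := by
      refine Tendsto.mono_left (Continuous.tendsto ?_ 0) nhdsWithin_le_nhds
      fun_prop
    -- The minorant `3 sin x / x ≤ Υ(x)`, equivalent to `3 (sin x - x cos x) ≤ x³`, carries the
    -- tangent bound to the filled-in value `3`.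
    have hl : Tendsto (fun r : ℝ => 3 * (r / sin r)⁻¹) (𝓝[>] 0) (𝓝 3) := by
      simpa using (tendsto_div_sin.inv₀ one_ne_zero).const_mul 3
    refine le_of_tendsto_of_tendsto hl hL ?_
    filter_upwards [Ioo_mem_nhdsGT pi_pos] with x hx
    have hx' : x ∈ Ioo 0 vartheta₁ := ⟨hx.1, hx.2.trans pi_lt_vartheta₁⟩
    refine le_trans ?_ (Upsilon_le_tangent_of_pos hx' hr₀)
    have hD := sinSubMulCos_pos hx'.1 hx'.2
    have hcub : 0 < x ^ 3 - 3 * sinSubMulCos x := by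
      refine pos_of_hasDerivAt_pos (f := fun y => y ^ 3 - 3 * sinSubMulCos y)
        (f' := fun y => 3 * (y * (y - sin y))) (b := π) (by simp [sinSubMulCos]) ?_ ?_ hx.1 hx.2.le
      · intro y
        refine (((hasDerivAt_id y).pow 3).sub
          ((hasDerivAt_sinSubMulCos y).const_mul 3)).congr_deriv ?_
        simp
        ring
      · exact fun y hy0 _ => mul_pos (by norm_num) (mul_pos hy0 (sub_pos.2 (sin_lt hy0)))
    rw [Upsilon_of_ne hx.1.ne', inv_div, mul_div_assoc', div_le_div_iff₀ hx.1 hD]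
    nlinarith [sin_pos_of_pos_of_lt_pi hx.1 hx.2]
  · exact Upsilon_le_tangent_of_pos ⟨h0, h1⟩ hr₀

/-! ### The dual curve -/

/-- The first coordinate `1 / (Υ - r Υ')` of the dual curve of the graph of `Υ`. -/
noncomputable def dualX (r : ℝ) : ℝ := sinSubMulCos r ^ 2 / (r ^ 2 * (r ^ 2 - sin r ^ 2))

/-- The second coordinate `-Υ' / (Υ - r Υ')` of the dual curve of the graph of `Υ`. -/
noncomputable def dualB (r : ℝ) : ℝ := hFun r / (r * (r ^ 2 - sin r ^ 2))

/-- The slope of `dualB ^ 2` as a function of `dualX`. -/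
noncomputable def dualSlope (r : ℝ) : ℝ :=
  2 * hFun r * (-sin r) / (sinSubMulCos r * (r ^ 2 - sin r ^ 2))

theorem hasDerivAt_sq_sub_sin_sq (r : ℝ) :
    HasDerivAt (fun r => r ^ 2 - sin r ^ 2) (2 * (r - sin r * cos r)) r := by
  refine (((hasDerivAt_id r).pow 2).sub ((hasDerivAt_sin r).pow 2)).congr_deriv ?_
  simp
  ring

theorem hasDerivAt_dualX {r : ℝ} (h0 : 0 < r) : HasDerivAt dualX
    (-(2 * curvNum r * sinSubMulCos r / (r ^ 3 * (r ^ 2 - sin r ^ 2) ^ 2))) r := by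
  have hA := (sq_sub_sin_sq_pos h0).ne'
  have h := ((hasDerivAt_sinSubMulCos r).pow 2).div
    (((hasDerivAt_id r).pow 2).mul (hasDerivAt_sq_sub_sin_sq r))
    (mul_ne_zero (pow_ne_zero 2 h0.ne') hA)
  refine h.congr_deriv ?_
  simp only [Pi.pow_apply, Pi.mul_apply, id, neg_div']
  rw [div_eq_div_iff (pow_ne_zero 2 (mul_ne_zero (pow_ne_zero 2 h0.ne') hA))
    (mul_ne_zero (pow_ne_zero 3 h0.ne') (pow_ne_zero 2 hA))]
  have key : curvNum r = sinSubMulCos r * (r ^ 2 - sin r ^ 2)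
      + r * sinSubMulCos r * (r - sin r * cos r) + r ^ 2 * (-sin r) * (r ^ 2 - sin r ^ 2) := by
    simp only [curvNum, sinSubMulCos]
    linear_combination (-(r ^ 2 * sin r)) * (sin_sq_add_cos_sq r)
  rw [key]
  push_cast
  ring

theorem hasDerivAt_dualB {r : ℝ} (h0 : 0 < r) : HasDerivAt dualB
    (2 * sin r * curvNum r / (r ^ 2 * (r ^ 2 - sin r ^ 2) ^ 2)) r := by
  have hA := (sq_sub_sin_sq_pos h0).ne'
  have h := (hasDerivAt_hFun r).div ((hasDerivAt_id r).mul (hasDerivAt_sq_sub_sin_sq r))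
    (mul_ne_zero h0.ne' hA)
  refine h.congr_deriv ?_
  simp only [Pi.mul_apply, id]
  rw [mul_pow]
  congr 1
  have hc : cos r ^ 2 = 1 - sin r ^ 2 := by linarith [sin_sq_add_cos_sq r]
  simp only [hFun, curvNum]
  ring_nf
  simp only [hc]
  ring

theorem dualX_vartheta₁ : dualX vartheta₁ = 0 := by
  simp [dualX, sinSubMulCos_vartheta₁]

theorem dualB_vartheta₁ : dualB vartheta₁ = 1 / vartheta₁ := by
  have h0 := vartheta₁_pos
  have hA := sq_sub_sin_sq_pos h0
  have hd : sin vartheta₁ - vartheta₁ * cos vartheta₁ = 0 := sinSubMulCos_vartheta₁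
  rw [dualB, div_eq_div_iff (by positivity) h0.ne']
  simp only [hFun]
  linear_combination (-(vartheta₁ * sin vartheta₁)) * hd

theorem dualB_pi : dualB π = 1 / π := by
  have := pi_pos
  simp only [dualB, hFun, sin_pi]
  field_simp
  ring

/-- As `dualX` decreases in `r`, this is the concavity of `dualB ^ 2` in `dualX`. -/
theorem monotoneOn_dualSlope : MonotoneOn dualSlope (Ico π vartheta₁) := by
  have hD : ∀ r ∈ Ico π vartheta₁, HasDerivAt dualSlope
      (2 * ((3 * r - 2 * r * sin r ^ 2 - 3 * sin r * cos r) * (-sin r) * sinSubMulCos r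
          * (r ^ 2 - sin r ^ 2)
        + hFun r * (r - sin r * cos r) * ((r - sin r * cos r) ^ 2
          + (sin r ^ 2) ^ 2)) / (sinSubMulCos r * (r ^ 2 - sin r ^ 2)) ^ 2) r := by
    intro r hr
    have h0 := pi_pos.trans_le hr.1
    have h := (((hasDerivAt_hFun r).const_mul 2).mul (hasDerivAt_sin r).neg).div
      ((hasDerivAt_sinSubMulCos r).mul (hasDerivAt_sq_sub_sin_sq r))
      (mul_pos (sinSubMulCos_pos h0 hr.2) (sq_sub_sin_sq_pos h0)).ne'
    refine h.congr_deriv ?_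
    simp only [Pi.mul_apply, Pi.neg_apply]
    congr 1
    have hc : cos r ^ 2 = 1 - sin r ^ 2 := by linarith [sin_sq_add_cos_sq r]
    -- This trades the term `2 sin r (sin r - r cos r)`, negative beyond `π`, for a sum of squares.
    have h1 : (r - sin r * cos r) ^ 2 + (sin r ^ 2) ^ 2
        = r ^ 2 - sin r ^ 2 + 2 * sin r * sinSubMulCos r := by
      simp only [sinSubMulCos]
      linear_combination (sin r ^ 2) * hc
    have h2 : r - sin r * cos r = r * sin r * sin r - cos r * sinSubMulCos r := by
      simp only [sinSubMulCos]
      linear_combination (-r) * hc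
    rw [h1]
    linear_combination (-2 * hFun r * (r ^ 2 - sin r ^ 2)) * h2
  apply monotoneOn_of_deriv_nonneg (convex_Ico _ _)
  · exact fun r hr => (hD r hr).continuousAt.continuousWithinAt
  · rw [interior_Ico]
    exact fun r hr => (hD r ⟨hr.1.le, hr.2⟩).differentiableAt.differentiableWithinAt
  · intro r hr
    rw [interior_Ico] at hr
    rw [(hD r ⟨hr.1.le, hr.2⟩).deriv]
    have h0 := pi_pos.trans hr.1
    have := deriv_hFun_pos_of_pi_le hr.1.le
    have := sinSubMulCos_pos h0 hr.2
    have := sq_sub_sin_sq_pos h0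
    have := sub_sin_mul_cos_pos h0
    have := hFun_pos h0
    have : 0 < -sin r := neg_pos.2 (sin_neg_of_mem hr.1 hr.2.le)
    positivity

/-- On `[π, ϑ₁]`, the square of the second coordinate of the dual curve lies below its tangents,
as a function of the first coordinate. -/
theorem dualB_sq_le_tangent {r r₀ : ℝ} (hr : r ∈ Icc π vartheta₁) (hr₀ : r₀ ∈ Ico π vartheta₁) :
    dualB r ^ 2 ≤ dualB r₀ ^ 2 + dualSlope r₀ * (dualX r - dualX r₀) := by
  set k : ℝ → ℝ := fun r => dualB r ^ 2 - dualSlope r₀ * dualX r with hk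
  have hD : ∀ r ∈ Icc π vartheta₁, HasDerivAt k
      (2 * dualB r * (2 * sin r * curvNum r / (r ^ 2 * (r ^ 2 - sin r ^ 2) ^ 2))
        - dualSlope r₀ *
          -(2 * curvNum r * sinSubMulCos r / (r ^ 3 * (r ^ 2 - sin r ^ 2) ^ 2))) r := by
    intro r hr
    have h0 := pi_pos.trans_le hr.1
    refine (((hasDerivAt_dualB h0).pow 2).sub ((hasDerivAt_dualX h0).const_mul _)).congr_deriv ?_
    simp
  have hD' : ∀ r ∈ Ioo π vartheta₁, deriv k r = (dualSlope r₀ - dualSlope r)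
      * (2 * curvNum r * sinSubMulCos r / (r ^ 3 * (r ^ 2 - sin r ^ 2) ^ 2)) := by
    intro r hr
    rw [(hD r ⟨hr.1.le, hr.2.le⟩).deriv]
    have h0 := pi_pos.trans hr.1
    have := sinSubMulCos_pos h0 hr.2
    have := sq_sub_sin_sq_pos h0
    have e : dualSlope r * (2 * curvNum r * sinSubMulCos r / (r ^ 3 * (r ^ 2 - sin r ^ 2) ^ 2))
        = -(2 * dualB r * (2 * sin r * curvNum r / (r ^ 2 * (r ^ 2 - sin r ^ 2) ^ 2))) := by
      simp only [dualSlope, dualB]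
      field_simp
    linear_combination e
  have hfac : ∀ r ∈ Ioo π vartheta₁,
      0 ≤ 2 * curvNum r * sinSubMulCos r / (r ^ 3 * (r ^ 2 - sin r ^ 2) ^ 2) := by
    intro r hr
    have h0 := pi_pos.trans hr.1
    have := sinSubMulCos_pos h0 hr.2
    have := sq_sub_sin_sq_pos h0
    have := curvNum_pos h0 hr.2
    positivity
  suffices k r ≤ k r₀ by
    simp only [hk] at this
    linarith
  -- `k` increases up to `r₀` and decreases afterwards, so `r₀` is its maximum.
  rcases le_total r r₀ with h | h
  · have hmono : MonotoneOn k (Icc π r₀) := by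
      apply monotoneOn_of_deriv_nonneg (convex_Icc _ _)
      · exact fun y hy => (hD y ⟨hy.1, hy.2.trans hr₀.2.le⟩).continuousAt.continuousWithinAt
      · rw [interior_Icc]
        exact fun y hy =>
          (hD y ⟨hy.1.le, hy.2.le.trans hr₀.2.le⟩).differentiableAt.differentiableWithinAt
      · intro y hy
        rw [interior_Icc] at hy
        have hy' : y ∈ Ioo π vartheta₁ := ⟨hy.1, hy.2.trans hr₀.2⟩
        rw [hD' y hy']
        exact mul_nonneg (sub_nonneg.2 (monotoneOn_dualSlope ⟨hy.1.le, hy'.2⟩ hr₀ hy.2.le))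
          (hfac y hy')
    exact hmono ⟨hr.1, h⟩ ⟨hr₀.1, le_rfl⟩ h
  · have hanti : AntitoneOn k (Icc r₀ vartheta₁) := by
      apply antitoneOn_of_deriv_nonpos (convex_Icc _ _)
      · exact fun y hy => (hD y ⟨hr₀.1.trans hy.1, hy.2⟩).continuousAt.continuousWithinAt
      · rw [interior_Icc]
        exact fun y hy =>
          (hD y ⟨hr₀.1.trans hy.1.le, hy.2.le⟩).differentiableAt.differentiableWithinAt
      · intro y hy
        rw [interior_Icc] at hy
        have hy' : y ∈ Ioo π vartheta₁ := ⟨hr₀.1.trans_lt hy.1, hy.2⟩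
        rw [hD' y hy']
        exact mul_nonpos_of_nonpos_of_nonneg
          (sub_nonpos.2 (monotoneOn_dualSlope hr₀ ⟨hy'.1.le, hy'.2⟩ hy.1.le)) (hfac y hy')
    exact hanti ⟨le_rfl, hr₀.2.le⟩ ⟨h, hr.2⟩ h

/-- The dual point encodes the tangent at `r`, which passes through `(r, Υ(r))`. -/
theorem Upsilon_mul_dualX_add {r : ℝ} (h0 : 0 < r) (h1 : r < vartheta₁) :
    Upsilon r * dualX r + r * dualB r = 1 := by
  have := sinSubMulCos_pos h0 h1
  have := sq_sub_sin_sq_pos h0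
  rw [Upsilon_of_ne h0.ne', dualX, dualB]
  field_simp
  simp only [hFun, sinSubMulCos]
  ring

/-- If `Q` exceeds, at `x`, the tangent at `r₀` of the (rescaled) square of the dual curve, then the
line dual to `(x, √Q)` is exceeded by the graph of `Υ`. -/
theorem exists_lt_Upsilon_mul_add {m x q r₀ : ℝ} (hm : 0 < m) (hx : 0 ≤ x) (hq : 0 ≤ q)
    (hr₀ : r₀ ∈ Ioo π vartheta₁)
    (hQ : m ^ 2 * dualB r₀ ^ 2 + m * dualSlope r₀ * (x - m * dualX r₀) < q ^ 2) :
    ∃ r, 0 < r ∧ r < vartheta₁ ∧ m < Upsilon r * x + r * q := by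
  have hpi := pi_pos
  have h0 : 0 < r₀ := hpi.trans hr₀.1
  have hr₀' : r₀ ∈ Ico π vartheta₁ := ⟨hr₀.1.le, hr₀.2⟩
  have hs : 0 < dualSlope r₀ := by
    have := hFun_pos h0
    have := sinSubMulCos_pos h0 hr₀.2
    have := sq_sub_sin_sq_pos h0
    have : 0 < -sin r₀ := neg_pos.2 (sin_neg_of_mem hr₀.1 hr₀.2.le)
    unfold dualSlope
    positivity
  have hlow : ∀ r ∈ Icc π vartheta₁, m * dualX r ≤ x → m * dualB r < q := by
    intro r hr hrx
    refine lt_of_pow_lt_pow_left₀ 2 hq (lt_of_le_of_lt ?_ hQ)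
    have h1 := mul_le_mul_of_nonneg_left (dualB_sq_le_tangent hr hr₀') (sq_nonneg m)
    have h2 := mul_le_mul_of_nonneg_left hrx (mul_pos hm hs).le
    nlinarith
  -- Past the end of the arc at `π`, the radius `π` serves for every `x`, because `Υ(π) = 0`.
  rcases le_or_gt (m * dualX π) x with hc | hc
  · refine ⟨π, hpi, pi_lt_vartheta₁, ?_⟩
    have := hlow π ⟨le_rfl, pi_lt_vartheta₁.le⟩ hc
    rw [dualB_pi, mul_one_div, div_lt_iff₀ hpi] at this
    rw [Upsilon_pi]
    linarith
  · have hcont : ContinuousOn (fun r => m * dualX r) (Icc π vartheta₁) := fun r hr =>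
      ((hasDerivAt_dualX (hpi.trans_le hr.1)).continuousAt.continuousWithinAt).const_mul m
    have hmem : x ∈ Icc (m * dualX vartheta₁) (m * dualX π) := by
      rw [dualX_vartheta₁, mul_zero]
      exact ⟨hx, hc.le⟩
    -- Otherwise the arc meets abscissa `x`, and the radius found there is the witness.
    obtain ⟨r, hr, hrx⟩ := intermediate_value_Icc' pi_lt_vartheta₁.le hcont hmem
    have hB := hlow r hr hrx.le
    rcases hr.2.lt_or_eq with h1 | h1
    · have hrpos := hpi.trans_le hr.1
      refine ⟨r, hrpos, h1, ?_⟩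
      have e := Upsilon_mul_dualX_add hrpos h1
      have := mul_lt_mul_of_pos_left hB hrpos
      simp only at hrx
      rw [← hrx]
      nlinarith
    -- The radius `ϑ₁` is not admissible, but here `x = 0`, so any radius in `(m / q, ϑ₁)` will do.
    · subst h1
      simp only [dualX_vartheta₁, mul_zero] at hrx
      rw [dualB_vartheta₁, mul_one_div, div_lt_iff₀ vartheta₁_pos] at hB
      have hq' : 0 < q := by
        by_contra hcon
        nlinarith [vartheta₁_pos]
      have hlt : m / q < vartheta₁ := by rwa [div_lt_iff₀' hq']
      obtain ⟨r, h1, h2⟩ := exists_between hlt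
      refine ⟨r, (div_pos hm hq').trans h1, h2, ?_⟩
      rw [div_lt_iff₀ hq'] at h1
      rw [← hrx]
      linarith

/-! ### `ψ` and the supremum -/

theorem psi_eq {r : ℝ} (hs : sin r ≠ 0) : psi r = sinSubMulCos r / (r ^ 2 * sin r) := by
  have h0 : r ≠ 0 := by
    rintro rfl
    simp at hs
  rw [psi, cot_eq_cos_div_sin, sinSubMulCos]
  field_simp

theorem deriv_psi {r : ℝ} (hs : sin r ≠ 0) : deriv psi r = hFun r / (r ^ 3 * sin r ^ 2) := by
  have h0 : r ≠ 0 := by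
    rintro rfl
    simp at hs
  have h := (hasDerivAt_sinSubMulCos r).div (((hasDerivAt_id r).pow 2).mul (hasDerivAt_sin r))
    (mul_ne_zero (pow_ne_zero 2 h0) hs)
  have h' : HasDerivAt (fun r => sinSubMulCos r / (r ^ 2 * sin r))
      (hFun r / (r ^ 3 * sin r ^ 2)) r := by
    refine h.congr_deriv ?_
    simp only [Pi.pow_apply, Pi.mul_apply, id]
    rw [div_eq_div_iff (pow_ne_zero 2 (mul_ne_zero (pow_ne_zero 2 h0) hs))
      (mul_ne_zero (pow_ne_zero 3 h0) (pow_ne_zero 2 hs))]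
    simp only [hFun, sinSubMulCos]
    push_cast
    linear_combination (r ^ 6 * sin r ^ 2) * (sin_sq_add_cos_sq r)
  refine (h'.congr_of_eventuallyEq ?_).deriv
  filter_upwards [(continuous_sin.isOpen_preimage _ isOpen_ne).mem_nhds hs] with x hx
  exact psi_eq hx

theorem Gam_quarter_smul (X : Plane) (P τ : Space) :
    Gam X ((1 / 4 : ℝ) • P) τ = Upsilon ‖τ‖ * ‖X‖ ^ 2 + inner ℝ P τ := by
  rw [Gam, real_inner_smul_left]
  ring

/-- The tangent to `Υ` at `π` bounds `Υ` by a constant on the whole range of radii. -/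
theorem bddAbove_Gam (X : Plane) (T : Space) :
    BddAbove (Gam X T '' Metric.ball 0 vartheta₁) := by
  have hpi : π ∈ Ioo 0 vartheta₁ := ⟨pi_pos, pi_lt_vartheta₁⟩
  refine ⟨π * hFun π / sinSubMulCos π ^ 2 * π * ‖X‖ ^ 2 + 4 * (‖T‖ * vartheta₁), ?_⟩
  rintro _ ⟨τ, hτ, rfl⟩
  rw [mem_ball_zero_iff] at hτ
  have h1 := Upsilon_le_tangent (norm_nonneg τ) hτ hpi
  rw [Upsilon_pi] at h1
  have hc : 0 ≤ π * hFun π / sinSubMulCos π ^ 2 := by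
    have := hFun_pos pi_pos
    have := pi_pos
    positivity
  have h2 : Upsilon ‖τ‖ ≤ π * hFun π / sinSubMulCos π ^ 2 * π := by
    have := mul_nonneg hc (norm_nonneg τ)
    linarith
  have h3 := real_inner_le_norm T τ
  have h4 := mul_le_mul_of_nonneg_left hτ.le (norm_nonneg T)
  rw [Gam]
  gcongr
  exact h3.trans h4

theorem Gam_le_intrinsicDistSq (X : Plane) (T : Space) {τ : Space} (hτ : ‖τ‖ < vartheta₁) :
    Gam X T τ ≤ intrinsicDistSq X T :=
  le_csSup (bddAbove_Gam X T) (mem_image_of_mem _ (mem_ball_zero_iff.2 hτ))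

/-- Taking `τ` along `P` reduces the search for a test point to its radius. -/
theorem Upsilon_mul_add_le_intrinsicDistSq (X : Plane) {P : Space} (hP : P ≠ 0) {r : ℝ}
    (h0 : 0 ≤ r) (h1 : r < vartheta₁) :
    Upsilon r * ‖X‖ ^ 2 + r * ‖P‖ ≤ intrinsicDistSq X ((1 / 4 : ℝ) • P) := by
  have hP' : ‖P‖ ≠ 0 := norm_ne_zero_iff.2 hP
  have hn : ‖(r / ‖P‖) • P‖ = r := by
    rw [norm_smul, norm_div, norm_norm, norm_eq_abs, abs_of_nonneg h0, div_mul_cancel₀ _ hP']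
  have h := Gam_le_intrinsicDistSq X ((1 / 4 : ℝ) • P) (τ := (r / ‖P‖) • P) (by rwa [hn])
  rw [Gam_quarter_smul, hn, real_inner_smul_right, real_inner_self_eq_norm_sq] at h
  convert h using 2
  field_simp

/-- The supremum is attained at a critical point of `Γ`. -/
theorem intrinsicDistSq_eq_of_critical (X : Plane) {P τ₀ : Space} (hτ₀ : τ₀ ≠ 0)
    (h1 : ‖τ₀‖ < vartheta₁)
    (hP : P = (‖X‖ ^ 2 * (hFun ‖τ₀‖ / sinSubMulCos ‖τ₀‖ ^ 2)) • τ₀) :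
    intrinsicDistSq X ((1 / 4 : ℝ) • P) = Upsilon ‖τ₀‖ * ‖X‖ ^ 2 + inner ℝ P τ₀ := by
  have h0 : 0 < ‖τ₀‖ := norm_pos_iff.2 hτ₀
  refine le_antisymm (csSup_le ?_ ?_) ?_
  · exact ⟨_, mem_image_of_mem _ (Metric.mem_ball_self vartheta₁_pos)⟩
  · rintro _ ⟨τ, hτ, rfl⟩
    rw [mem_ball_zero_iff] at hτ
    rw [Gam_quarter_smul, hP, real_inner_smul_left, real_inner_smul_left,
      real_inner_self_eq_norm_sq]
    have h2 := mul_le_mul_of_nonneg_right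
      (Upsilon_le_tangent (norm_nonneg τ) hτ ⟨h0, h1⟩) (sq_nonneg ‖X‖)
    have hc : 0 ≤ ‖X‖ ^ 2 * (hFun ‖τ₀‖ / sinSubMulCos ‖τ₀‖ ^ 2) := by
      have := hFun_pos h0
      positivity
    have h3 := mul_le_mul_of_nonneg_left (real_inner_le_norm τ₀ τ) hc
    have e : (Upsilon ‖τ₀‖ - ‖τ₀‖ * hFun ‖τ₀‖ / sinSubMulCos ‖τ₀‖ ^ 2 * (‖τ‖ - ‖τ₀‖)) * ‖X‖ ^ 2
        = Upsilon ‖τ₀‖ * ‖X‖ ^ 2 + ‖X‖ ^ 2 * (hFun ‖τ₀‖ / sinSubMulCos ‖τ₀‖ ^ 2) * ‖τ₀‖ ^ 2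
          - ‖X‖ ^ 2 * (hFun ‖τ₀‖ / sinSubMulCos ‖τ₀‖ ^ 2) * (‖τ₀‖ * ‖τ‖) := by ring
    linarith
  · have h := Gam_le_intrinsicDistSq X ((1 / 4 : ℝ) • P) h1
    rwa [Gam_quarter_smul] at h

theorem calD_eq (w u₀ u₁ : ℝ) (s : Plane) :
    calD w !₂[u₀, u₁, 0] s =
      intrinsicDistSq (w • s) ((1 / 4 : ℝ) • !₂[u₀, u₁ + 2 * w * s 0, 2 * w * s 1]) := by
  rw [calD]
  congr 2
  ext i
  fin_cases i <;> simp

theorem norm_sq_eq_plane (s : Plane) : ‖s‖ ^ 2 = s 0 ^ 2 + s 1 ^ 2 := by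
  simp [EuclideanSpace.norm_sq_eq, Fin.sum_univ_two]

theorem norm_sq_eq_space (τ : Space) : ‖τ‖ ^ 2 = τ 0 ^ 2 + τ 1 ^ 2 + τ 2 ^ 2 := by
  simp [EuclideanSpace.norm_sq_eq, Fin.sum_univ_three]

theorem norm_space_of_plane (v : Plane) : ‖(!₂[v 0, v 1, 0] : Space)‖ = ‖v‖ := by
  rw [← sq_eq_sq₀ (norm_nonneg _) (norm_nonneg _), norm_sq_eq_space, norm_sq_eq_plane]
  simp

theorem inner_space (a b c a' b' c' : ℝ) :
    inner ℝ (!₂[a, b, c] : Space) !₂[a', b', c'] = a * a' + b * b' + c * c' := by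
  simp [PiLp.inner_apply, Fin.sum_univ_three]
  ring

/-! ### The minimum value and strict minimality -/

/-- The range of `|v|` for `v ∈ Ω_{+,1} ∪ Ω_{-,4}`. -/
theorem norm_mem_of_mem {v : Plane} (hv : v ∈ OmegaPlus ∪ OmegaMinus) :
    0 < v 0 ∧ v 1 ≠ 0 ∧ ‖v‖ < vartheta₁ ∧ sin ‖v‖ ≠ 0 := by
  rcases hv with ⟨h0, h1, h2⟩ | ⟨h1, h0, h2, h3, -⟩
  · rw [← norm_sq_eq_plane] at h2
    have hlt := lt_of_pow_lt_pow_left₀ 2 pi_pos.le h2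
    have hpos : 0 < ‖v‖ := norm_pos_iff.2 fun h => by simp [h] at h0
    exact ⟨h0, h1.ne', hlt.trans pi_lt_vartheta₁, (sin_pos_of_pos_of_lt_pi hpos hlt).ne'⟩
  · exact ⟨pi_pos.trans h0, h1.ne, h3, (sin_neg_of_mem (h0.trans h2) h3.le).ne⟩

/-- The value of `𝒟(u; ·)` at `(-1, 0)`. -/
noncomputable def minValue (v : Plane) : ℝ :=
  v 1 ^ 2 * (‖v‖ ^ 2 - sin ‖v‖ ^ 2) / (‖v‖ ^ 2 * sin ‖v‖ ^ 2)

theorem Lam_zero {v : Plane} (hs : sin ‖v‖ ≠ 0) :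
    Lam v 0 = v 1 ^ 2 * v 0 * hFun ‖v‖ / (‖v‖ ^ 4 * sin ‖v‖ ^ 2) := by
  have h0 : ‖v‖ ≠ 0 := by
    intro h
    simp [h] at hs
  simp [Lam, deriv_psi hs]
  field_simp

theorem Lam_one {v : Plane} (hs : sin ‖v‖ ≠ 0) :
    Lam v 1 = v 1 * (v 1 ^ 2 * hFun ‖v‖ / (‖v‖ ^ 4 * sin ‖v‖ ^ 2) + 2 * psi ‖v‖) := by
  have h0 : ‖v‖ ≠ 0 := by
    intro h
    simp [h] at hs
  simp [Lam, deriv_psi hs]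
  field_simp

/-- The shift by `-2 w e₂` cancels the `2 ψ e₂` part of `Λ`; what is left is the multiple of `θ`
that makes `θ` critical. -/
theorem calD_neg_one {v : Plane} (hv : v ∈ OmegaPlus ∪ OmegaMinus) :
    calD (v 1 * psi ‖v‖) !₂[Lam v 0, Lam v 1, 0] !₂[-1, 0] = minValue v := by
  obtain ⟨h0, h1, h2, hs⟩ := norm_mem_of_mem hv
  have hr : 0 < ‖v‖ := norm_pos_iff.2 fun h => by simp [h] at h0
  have hd := sinSubMulCos_pos hr h2
  have hn := norm_space_of_plane v
  have hX : ‖(v 1 * psi ‖v‖) • (!₂[-1, 0] : Plane)‖ ^ 2 = (v 1 * psi ‖v‖) ^ 2 := by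
    rw [norm_sq_eq_plane]
    simp
  have hP : (!₂[Lam v 0, Lam v 1 + 2 * (v 1 * psi ‖v‖) * (!₂[-1, 0] : Plane) 0,
      2 * (v 1 * psi ‖v‖) * (!₂[-1, 0] : Plane) 1] : Space) =
      (v 1 ^ 2 * hFun ‖v‖ / (‖v‖ ^ 4 * sin ‖v‖ ^ 2)) • !₂[v 0, v 1, 0] := by
    ext i
    fin_cases i
    · simp [Lam_zero hs]; ring
    · simp [Lam_one hs]; ring
    · simp
  have hv0 : (!₂[v 0, v 1, 0] : Space) ≠ 0 := by
    rw [← norm_ne_zero_iff, hn]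
    exact hr.ne'
  have hcr := intrinsicDistSq_eq_of_critical ((v 1 * psi ‖v‖) • (!₂[-1, 0] : Plane))
    (P := (v 1 ^ 2 * hFun ‖v‖ / (‖v‖ ^ 4 * sin ‖v‖ ^ 2)) • !₂[v 0, v 1, 0]) hv0
    (by rwa [hn]) (by
      rw [hX, hn, psi_eq hs]
      congr 1
      field_simp)
  rw [calD_eq, hP, hcr, hX, hn, real_inner_smul_left, real_inner_self_eq_norm_sq, hn, psi_eq hs,
    Upsilon_of_ne hr.ne', minValue]
  field_simp
  simp only [hFun, sinSubMulCos]
  ring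

/-- Away from `(-1, 0)`, the point `θ` itself already exceeds the minimum value when `|θ| < π`. -/
theorem minValue_lt_calD_of_mem_OmegaPlus {v : Plane} (hv : v ∈ OmegaPlus) {s : Plane}
    (hs : s ≠ !₂[-1, 0]) :
    minValue v < calD (v 1 * psi ‖v‖) !₂[Lam v 0, Lam v 1, 0] s := by
  obtain ⟨h0, h1, h2, hsin⟩ := norm_mem_of_mem (Or.inl hv)
  have hr : 0 < ‖v‖ := norm_pos_iff.2 fun h => by simp [h] at h0
  have hd := sinSubMulCos_pos hr h2
  have hlt : ‖v‖ < π := by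
    have := hv.2.2
    rw [← norm_sq_eq_plane] at this
    exact lt_of_pow_lt_pow_left₀ 2 pi_pos.le this
  have hS := sin_pos_of_pos_of_lt_pi hr hlt
  have hn := norm_space_of_plane v
  have h := Gam_le_intrinsicDistSq ((v 1 * psi ‖v‖) • s) ((1 / 4 : ℝ) •
    (!₂[Lam v 0, Lam v 1 + 2 * (v 1 * psi ‖v‖) * s 0, 2 * (v 1 * psi ‖v‖) * s 1] : Space))
    (τ := !₂[v 0, v 1, 0]) (by rwa [hn])
  rw [calD_eq]
  refine lt_of_lt_of_le ?_ h
  rw [Gam_quarter_smul, hn, inner_space, norm_smul, mul_pow, norm_eq_abs, sq_abs,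
    norm_sq_eq_plane, Lam_zero hsin, Lam_one hsin]
  have hpos : 0 < (s 0 + 1) ^ 2 + s 1 ^ 2 := by
    by_contra hcon
    have ha : s 0 + 1 = 0 := by nlinarith [sq_nonneg (s 0 + 1), sq_nonneg (s 1)]
    have hb : s 1 = 0 := by nlinarith [sq_nonneg (s 0 + 1), sq_nonneg (s 1)]
    refine hs ?_
    ext i
    fin_cases i
    · simp; linarith
    · simpa using hb
  have e : Upsilon ‖v‖ * ((v 1 * psi ‖v‖) ^ 2 * (s 0 ^ 2 + s 1 ^ 2)) +
      (v 1 ^ 2 * v 0 * hFun ‖v‖ / (‖v‖ ^ 4 * sin ‖v‖ ^ 2) * v 0 +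
        (v 1 * (v 1 ^ 2 * hFun ‖v‖ / (‖v‖ ^ 4 * sin ‖v‖ ^ 2) + 2 * psi ‖v‖) +
          2 * (v 1 * psi ‖v‖) * s 0) * v 1 + 2 * (v 1 * psi ‖v‖) * s 1 * 0) =
      minValue v + v 1 ^ 2 * psi ‖v‖ * ((s 0 + 1) ^ 2 + s 1 ^ 2) := by
    have hUp : Upsilon ‖v‖ * psi ‖v‖ = 1 := by
      rw [psi_eq hsin, Upsilon_of_ne hr.ne']
      field_simp
    have hm : minValue v = v 1 ^ 2 * hFun ‖v‖ / (‖v‖ ^ 4 * sin ‖v‖ ^ 2) * (v 0 ^ 2 + v 1 ^ 2)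
        + v 1 ^ 2 * psi ‖v‖ := by
      rw [← norm_sq_eq_plane, psi_eq hsin, minValue]
      field_simp
      simp only [hFun, sinSubMulCos]
      ring
    rw [hm]
    linear_combination (v 1 ^ 2 * psi ‖v‖ * (s 0 ^ 2 + s 1 ^ 2)) * hUp
  rw [e]
  have : 0 < psi ‖v‖ := by
    rw [psi_eq hsin]
    positivity
  have : 0 < v 1 := hv.2.1
  have : 0 < v 1 ^ 2 * psi ‖v‖ * ((s 0 + 1) ^ 2 + s 1 ^ 2) := by positivity
  linarith

theorem minValue_lt_calD_of_mem_OmegaMinus {v : Plane} (hv : v ∈ OmegaMinus) {s : Plane}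
    (hs : s ≠ !₂[-1, 0]) :
    minValue v < calD (v 1 * psi ‖v‖) !₂[Lam v 0, Lam v 1, 0] s := by
  obtain ⟨h0, h1, h2, hsin⟩ := norm_mem_of_mem (Or.inr hv)
  obtain ⟨hv1, hv0, hv0r, -, hK⟩ := hv
  have hr : 0 < ‖v‖ := norm_pos_iff.2 fun h => by simp [h] at h0
  have hd := sinSubMulCos_pos hr h2
  have hh := hFun_pos hr
  have hA := sq_sub_sin_sq_pos hr
  have hS := sin_neg_of_mem (hv0.trans hv0r) h2.le
  have hr₀ : ‖v‖ ∈ Ioo π vartheta₁ := ⟨hv0.trans hv0r, h2⟩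
  set w := v 1 * psi ‖v‖ with hw
  have hψ : psi ‖v‖ < 0 := by
    rw [psi_eq hsin]
    exact div_neg_of_pos_of_neg hd (mul_neg_of_pos_of_neg (by positivity) hS)
  have hwpos : 0 < w := mul_pos_of_neg_of_neg hv1 hψ
  have hu0 : 0 < Lam v 0 := by
    rw [Lam_zero hsin]
    positivity
  have hu1 : 0 < Lam v 1 := by
    rw [Lam_one hsin]
    refine mul_pos_of_neg_of_neg hv1 ?_
    rw [K₃, deriv_psi hsin] at hK
    refine lt_of_eq_of_lt ?_ hK
    field_simp
    ring
  have hm : 0 < minValue v := by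
    unfold minValue
    positivity
  set P : Space := !₂[Lam v 0, Lam v 1 + 2 * w * s 0, 2 * w * s 1] with hPdef
  have hP0 : P ≠ 0 := by
    intro h
    have : P 0 = 0 := by rw [h]; simp
    simp [hPdef] at this
    exact hu0.ne' this
  have hPsq : ‖P‖ ^ 2 = Lam v 0 ^ 2 + (Lam v 1 - 2 * (w * ‖s‖)) ^ 2
      + 4 * w * Lam v 1 * (s 0 + ‖s‖) := by
    rw [norm_sq_eq_space]
    simp [hPdef]
    linear_combination (-4 * w ^ 2) * norm_sq_eq_plane s
  have hs0 : 0 ≤ s 0 + ‖s‖ := by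
    have := abs_le_of_sq_le_sq' (a := s 0) (b := ‖s‖)
      (by rw [norm_sq_eq_plane]; nlinarith [sq_nonneg (s 1)]) (norm_nonneg s)
    linarith [this.1]
  have hQ : Lam v 0 ^ 2 + (Lam v 1 - 2 * (w * ‖s‖)) ^ 2 = minValue v ^ 2 * dualB ‖v‖ ^ 2
      + minValue v * dualSlope ‖v‖ * (w ^ 2 * ‖s‖ ^ 2 - minValue v * dualX ‖v‖)
      + 2 * Lam v 1 * w * (‖s‖ - 1) ^ 2 := by
    have hX : minValue v * dualX ‖v‖ = w ^ 2 := by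
      rw [minValue, dualX, hw, psi_eq hsin]
      field_simp
    have hB : minValue v ^ 2 * dualB ‖v‖ ^ 2 = Lam v 0 ^ 2 + (Lam v 1 - 2 * w) ^ 2 := by
      have e : Lam v 0 ^ 2 + (Lam v 1 - 2 * w) ^ 2
          = (v 1 ^ 2 * hFun ‖v‖ / (‖v‖ ^ 4 * sin ‖v‖ ^ 2)) ^ 2 * ‖v‖ ^ 2 := by
        rw [Lam_zero hsin, Lam_one hsin, hw, norm_sq_eq_plane v]
        ring
      rw [e, minValue, dualB]
      field_simp
    have hj : minValue v * dualSlope ‖v‖ * w = 4 * w - 2 * Lam v 1 := by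
      rw [minValue, dualSlope, Lam_one hsin, hw, psi_eq hsin]
      field_simp
      ring
    rw [hX, hB]
    linear_combination (-w * (‖s‖ ^ 2 - 1)) * hj
  have hXn : ‖w • s‖ ^ 2 = w ^ 2 * ‖s‖ ^ 2 := by
    rw [norm_smul, mul_pow, norm_eq_abs, sq_abs]
  have hlt : minValue v ^ 2 * dualB ‖v‖ ^ 2
      + minValue v * dualSlope ‖v‖ * (w ^ 2 * ‖s‖ ^ 2 - minValue v * dualX ‖v‖) < ‖P‖ ^ 2 := by
    rw [hPsq, hQ]
    have e1 : 0 ≤ 2 * Lam v 1 * w * (‖s‖ - 1) ^ 2 := by positivity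
    have e2 : 0 ≤ 4 * w * Lam v 1 * (s 0 + ‖s‖) := by positivity
    by_cases hs1 : ‖s‖ = 1
    · have : 0 < s 0 + ‖s‖ := by
        refine lt_of_le_of_ne hs0 fun h => hs ?_
        have hsq := norm_sq_eq_plane s
        rw [hs1] at hsq h
        have ha : s 0 = -1 := by linarith
        have hb : s 1 = 0 := by
          rw [ha] at hsq
          nlinarith
        ext i
        fin_cases i
        · simpa using ha
        · simpa using hb
      have e3 : 0 < 4 * w * Lam v 1 * (s 0 + ‖s‖) := by positivity
      linarith
    · have : 0 < (‖s‖ - 1) ^ 2 := pow_two_pos_of_ne_zero (sub_ne_zero.2 hs1)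
      have e3 : 0 < 2 * Lam v 1 * w * (‖s‖ - 1) ^ 2 := by positivity
      linarith
  obtain ⟨r, hr0, hr1, hr2⟩ := exists_lt_Upsilon_mul_add hm
    (by positivity : 0 ≤ w ^ 2 * ‖s‖ ^ 2) (norm_nonneg P) hr₀ hlt
  rw [calD_eq]
  refine hr2.trans_le ?_
  rw [← hXn]
  exact Upsilon_mul_add_le_intrinsicDistSq (w • s) hP0 hr0.le hr1

theorem theorem2p4 (v : Plane) (hv : v ∈ OmegaPlus ∪ OmegaMinus)
    (θ u : Space) (w : ℝ)
    (hθ : θ = !₂[v 0, v 1, 0])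
    (hu : u = !₂[Lam v 0, Lam v 1, 0])
    (hw : w = θ 1 * psi ‖θ‖) :
    -- every supremum that defines `𝐃²` is finite
    (∀ (X : Plane) (T : Space), BddAbove (Gam X T '' Metric.ball 0 vartheta₁)) ∧
    -- `(-1, 0)` is the one and only minimum point of `𝒟(u; ·)`
    (∀ s : Plane, IsMinOn (calD w u) Set.univ s ↔ s = !₂[-1, 0]) ∧
    -- the minimum value
    calD w u !₂[-1, 0] = -(θ 1 ^ 2) * psi ‖θ‖ + inner ℝ u θ ∧
    calD w u !₂[-1, 0] =
      θ 1 ^ 2 / ‖θ‖ ^ 2 * ((‖θ‖ / Real.sin ‖θ‖) ^ 2 - 1) ∧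
    calD w u !₂[-1, 0] = phi₁ ‖θ‖ / ‖θ‖ * inner ℝ u θ ∧
    calD w u !₂[-1, 0] = phi₂ ‖θ‖ * u 0 * (‖θ‖ / θ 0) ∧
    calD w u !₂[-1, 0] = phi₃ ‖θ‖ * √(u 0 * (u 0 + u 1 * (θ 1 / θ 0))) := by
  have hn : ‖θ‖ = ‖v‖ := by rw [hθ, norm_space_of_plane]
  have hθ0 : θ 0 = v 0 := by simp [hθ]
  have hθ1 : θ 1 = v 1 := by simp [hθ]
  have hu0 : u 0 = Lam v 0 := by simp [hu]
  have hu1 : u 1 = Lam v 1 := by simp [hu]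
  have hin : inner ℝ u θ = Lam v 0 * v 0 + Lam v 1 * v 1 := by
    rw [hu, hθ, inner_space]
    ring
  have hval : calD w u !₂[-1, 0] = minValue v := by
    rw [hw, hu, hn, hθ1]
    exact calD_neg_one hv
  have hmin : ∀ s : Plane, s ≠ !₂[-1, 0] → calD w u !₂[-1, 0] < calD w u s := by
    intro s hs
    rw [hval, hw, hu, hn, hθ1]
    rcases hv with hv | hv
    · exact minValue_lt_calD_of_mem_OmegaPlus hv hs
    · exact minValue_lt_calD_of_mem_OmegaMinus hv hs
  obtain ⟨h0, h1, h2, hs⟩ := norm_mem_of_mem hv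
  have hr : 0 < ‖v‖ := norm_pos_iff.2 fun h => by simp [h] at h0
  have hd := sinSubMulCos_pos hr h2
  have hh := hFun_pos hr
  have hA := sq_sub_sin_sq_pos hr
  have hq := sub_sin_mul_cos_pos hr
  have hinner : Lam v 0 * v 0 + Lam v 1 * v 1
      = v 1 ^ 2 * (‖v‖ - sin ‖v‖ * cos ‖v‖) / (‖v‖ * sin ‖v‖ ^ 2) := by
    have e : Lam v 0 * v 0 + Lam v 1 * v 1
        = v 1 ^ 2 * hFun ‖v‖ / (‖v‖ ^ 4 * sin ‖v‖ ^ 2) * ‖v‖ ^ 2 + 2 * v 1 ^ 2 * psi ‖v‖ := by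
      rw [Lam_zero hs, Lam_one hs, norm_sq_eq_plane]
      ring
    rw [e, psi_eq hs]
    field_simp
    simp only [hFun, sinSubMulCos]
    ring
  have hphi₂ : phi₂ ‖v‖ = ‖v‖ * (‖v‖ ^ 2 - sin ‖v‖ ^ 2) / hFun ‖v‖ := rfl
  rw [hval, hn, hθ0, hθ1, hu0, hu1, hin]
  refine ⟨bddAbove_Gam, fun s => ⟨fun h => ?_, ?_⟩, ?_, ?_, ?_, ?_, ?_⟩
  · by_contra hne
    exact absurd (isMinOn_iff.1 h !₂[-1, 0] (mem_univ _)) (not_le.2 (hmin s hne))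
  · rintro rfl
    refine isMinOn_iff.2 fun s _ => ?_
    by_cases h : s = !₂[-1, 0]
    · rw [h]
    · exact (hmin s h).le
  · rw [hinner, psi_eq hs, minValue]
    field_simp
    simp only [sinSubMulCos]
    ring
  · rw [minValue]
    field_simp
  · rw [hinner, minValue, phi₁]
    field_simp
  · rw [hphi₂, Lam_zero hs, minValue]
    field_simp
  · have e : Lam v 0 * (Lam v 0 + Lam v 1 * (v 1 / v 0))
        = Lam v 0 / v 0 * (Lam v 0 * v 0 + Lam v 1 * v 1) := by
      field_simp
    have hφ₁ : 0 < phi₁ ‖v‖ := div_pos hA hq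
    have hφ₂ : 0 < phi₂ ‖v‖ := by
      rw [hphi₂]
      positivity
    have hm : 0 ≤ minValue v := by
      unfold minValue
      positivity
    rw [phi₃, ← sqrt_mul (by positivity), e, hinner, Lam_zero hs]
    refine (sqrt_eq_iff_eq_sq ?_ hm).2 ?_ |>.symm
    · positivity
    · rw [hphi₂, phi₁, minValue]
      field_simp
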